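/- Let $I$ be an arbitrary set (of agents), and let $L_I$ be the language built from countably many proposition letters $p_0,p_1,\dots$ with $\neg$, $\wedge$ and unary operators $K_i$, $A_i$ for each $i\in I$; $\to$, $\leftrightarrow$ and $\top$ are the usual abbreviations. A \emph{partitional model} $M=\langle\Omega,R^i,\approx^i\rangle_{i\in I}$ consists of a set $\Omega$ and, for each $i\in I$, a reflexive and transitive relation $R^i$ on $\Omega$ and a function $\approx^i$ assigning to each $\omega\in\Omega$ an equivalence relation $\approx^i_\omega$ on $\Omega$. Given a valuation $v$ of the proposition letters by subsets of $\Omega$, each formula $\varphi$ expresses a set $[\![\varphi]\!]\subseteq\Omega$: $[\![p]\!]=v(p)$, negation and conjunction are complement and intersection, $[\![K_i\varphi]\!]=\{\sigma : \tau\in[\![\varphi]\!]\text{ for all }\tau\text{ with }R^i\sigma\tau\}$, and $[\![A_i\varphi]\!]=\{\sigma : \text{for all }\rho,\tau\text{ with }\rho\approx^i_\sigma\tau,\ \rho\in[\![\varphi]\!]\text{ iff }\tau\in[\![\varphi]\!]\}$. The formula $\varphi$ is \emph{valid on} $M$ if $[\![\varphi]\!]=\Omega$ for every valuation $v$. Consider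 the calculus with the following axiom schemas and rules, for all $i\in I$ and formulas $\varphi,\psi$ of $L_I$: \begin{itemize} \item PL: every substitution instance of a theorem of classical propositional logic; \item K-K: $K_i(\varphi\to\psi)\to(K_i\varphi\to K_i\psi)$; K-T: $K_i\varphi\to\varphi$; K-4: $K_i\varphi\to K_iK_i\varphi$; \item A-Neg: $A_i\varphi\to A_i\neg\varphi$; A-M: $(A_i\varphi\wedge A_i\psi)\to A_i(\varphi\wedge\psi)$; A-N: $A_i\top$; \item MP: from $\vdash\varphi$ and $\vdash\varphi\to\psi$ infer $\vdash\psi$; K-RN: from $\vdash\varphi$ infer $\vdash K_i\varphi$; A-RE: from $\vdash\varphi\leftrightarrow\psi$ infer $\vdash A_i\varphi\leftrightarrow A_i\psi$. \end{itemize} Then: \begin{enumerate} \item A formula of $L_I$ is valid on all partitional models if and only if it is derivable in this calculus. \item (Finite model property) Every formula of $L_I$ that is not derivable fails to be valid on some partitional model with finitely many states. \item (Decidability) The set of formulas valid on all partitional models is decidable. That is, for every effectively coded set $J$ of names for agents in $I$ (distinct names naming distinct agents; $J=I$ if $I$ itself is effectively coded, for instance finite or $I=\mathbb{N}$), there is an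 algorithm which, given any finite string of symbols of $L_J$, decides whether it is a formula that is valid on all partitional models when its names are read as the agents they name. \end{enumerate} -/

import Mathlib

universe u v w

namespace Unawareness

/-- Formulas of the language `L_I`: proposition letters (indexed by `ℕ`), negation, conjunction,
and for each agent `i : I` the operators `K_i` (knowledge) and `A_i` (awareness). -/
inductive Formula (I : Type u) : Type u
  | letter : ℕ → Formula I
  | neg : Formula I → Formula I
  | and : Formula I → Formula I → Formula I
  | K : I → Formula I → Formula I
  | A : I → Formula I → Formula I

namespace Formula

variable {I : Type u} {J : Type v}

/-- Material implication, as an abbreviation. -/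
def imp (φ ψ : Formula I) : Formula I := neg (and φ (neg ψ))

/-- Bi-implication, as an abbreviation. -/
def iff (φ ψ : Formula I) : Formula I := and (imp φ ψ) (imp ψ φ)

/-- A fixed tautology. -/
def top : Formula I := neg (and (letter 0) (neg (letter 0)))

/-- Renaming of agents. -/
def map (e : J → I) : Formula J → Formula I
  | letter n => letter n
  | neg φ => neg (map e φ)
  | and φ ψ => and (map e φ) (map e ψ)
  | K j φ => K (e j) (map e φ)
  | A j φ => A (e j) (map e φ)

end Formula

/-! ### Semantics -/

/-- A standard state space model `⟨Ω, k^i, a^i⟩`. -/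
structure StandardModel (I : Type u) (Ω : Type w) where
  k : I → Set Ω → Set Ω
  a : I → Set Ω → Set Ω

namespace StandardModel

variable {I : Type u} {Ω : Type w}

/-- The event expressed by a formula relative to a valuation. -/
def interp (M : StandardModel I Ω) (val : ℕ → Set Ω) : Formula I → Set Ω
  | .letter n => val n
  | .neg φ => (M.interp val φ)ᶜ
  | .and φ ψ => M.interp val φ ∩ M.interp val ψ
  | .K i φ => M.k i (M.interp val φ)
  | .A i φ => M.a i (M.interp val φ)

/-- `φ` is valid on `M`: it expresses the set of all states under every valuation. -/
def Valid (M : StandardModel I Ω) (φ : Formula I) : Prop :=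
  ∀ val : ℕ → Set Ω, M.interp val φ = Set.univ

end StandardModel

/-- A partitional model `⟨Ω, R^i, ≈^i⟩`: each `R^i` is a reflexive and transitive relation on `Ω`,
and `≈^i` maps each state to an equivalence relation on `Ω`. -/
structure PartitionalModel (I : Type u) (Ω : Type w) where
  R : I → Ω → Ω → Prop
  refl : ∀ i σ, R i σ σ
  trans : ∀ i σ τ ρ, R i σ τ → R i τ ρ → R i σ ρ
  approx : I → Ω → Setoid Ω

namespace PartitionalModel

variable {I : Type u} {Ω : Type w}

/-- The standard model determined by a partitional model. -/
def toStandard (M : PartitionalModel I Ω) : StandardModel I Ω where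
  k i E := {σ | {τ | M.R i σ τ} ⊆ E}
  a i E := {σ | ∀ ρ τ, (M.approx i σ) ρ τ → (ρ ∈ E ↔ τ ∈ E)}

/-- Validity of a formula on a partitional model. -/
def Valid (M : PartitionalModel I Ω) (φ : Formula I) : Prop := M.toStandard.Valid φ

end PartitionalModel

/-- The logic of partitional models: the set of formulas valid on all partitional models
(with state spaces in an arbitrary universe `Type w`). -/
def logic (I : Type u) : Set (Formula I) :=
  {φ | ∀ (Ω : Type w) (M : PartitionalModel I Ω), M.Valid φ}

/-! ### The calculus -/

/-- Formulas of classical propositional logic. -/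
inductive PropFormula : Type
  | var : ℕ → PropFormula
  | neg : PropFormula → PropFormula
  | and : PropFormula → PropFormula → PropFormula

namespace PropFormula

/-- Truth value under a truth assignment. -/
def eval (t : ℕ → Bool) : PropFormula → Bool
  | var n => t n
  | neg p => !(eval t p)
  | and p q => eval t p && eval t q

/-- `p` is a theorem of classical propositional logic. -/
def Tautology (p : PropFormula) : Prop := ∀ t : ℕ → Bool, p.eval t = true

/-- The substitution instance of `p` under `s`. -/
def subst {I : Type u} (s : ℕ → Formula I) : PropFormula → Formula I
  | var n => s n
  | neg p => .neg (subst s p)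
  | and p q => .and (subst s p) (subst s q)

end PropFormula

/-- Derivability in the calculus. -/
inductive Derivable {I : Type u} : Formula I → Prop
  | pl (p : PropFormula) (s : ℕ → Formula I) : p.Tautology → Derivable (p.subst s)
  | k_k (i : I) (φ ψ : Formula I) :
      Derivable (((φ.imp ψ).K i).imp ((φ.K i).imp (ψ.K i)))
  | k_t (i : I) (φ : Formula I) : Derivable ((φ.K i).imp φ)
  | k_4 (i : I) (φ : Formula I) : Derivable ((φ.K i).imp ((φ.K i).K i))
  | a_neg (i : I) (φ : Formula I) : Derivable ((φ.A i).imp (φ.neg.A i))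
  | a_m (i : I) (φ ψ : Formula I) :
      Derivable (((φ.A i).and (ψ.A i)).imp ((φ.and ψ).A i))
  | a_n (i : I) : Derivable (Formula.top.A i)
  | mp (φ ψ : Formula I) : Derivable φ → Derivable (φ.imp ψ) → Derivable ψ
  | k_rn (i : I) (φ : Formula I) : Derivable φ → Derivable (φ.K i)
  | a_re (i : I) (φ ψ : Formula I) : Derivable (φ.iff ψ) → Derivable ((φ.A i).iff (ψ.A i))

/-! ### Decidability -/

/-- The alphabet of the language: a proposition letter, one of the two Boolean connectives
(`false` for negation, `true` for conjunction), an operator `K_j`, or an operator `A_j`. -/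
abbrev Alphabet (J : Type v) : Type v := ℕ ⊕ Bool ⊕ J ⊕ J

/-- A formula written as a string over the alphabet, in Polish notation. -/
def Formula.word {J : Type v} : Formula J → List (Alphabet J)
  | .letter n => [.inl n]
  | .neg φ => .inr (.inl false) :: φ.word
  | .and φ ψ => .inr (.inl true) :: (φ.word ++ ψ.word)
  | .K j φ => .inr (.inr (.inl j)) :: φ.word
  | .A j φ => .inr (.inr (.inr j)) :: φ.word

/-- Unique readability. -/
theorem Formula.word_append_inj {J : Type v} (φ : Formula J) :
    ∀ (ψ : Formula J) (x y : List (Alphabet J)),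
      φ.word ++ x = ψ.word ++ y → φ = ψ ∧ x = y := by
  induction φ with
  | letter n => intro ψ x y h; cases ψ <;> simp_all [Formula.word]
  | neg φ ih =>
    intro ψ x y h
    cases ψ <;> simp only [Formula.word, List.cons_append, List.cons.injEq, reduceCtorEq,
      Sum.inr.injEq, Sum.inl.injEq, false_and, List.nil_append, true_and] at h
    obtain ⟨rfl, rfl⟩ := ih _ _ _ h
    exact ⟨rfl, rfl⟩
  | and φ₁ φ₂ ih₁ ih₂ =>
    intro ψ x y h
    cases ψ <;> simp only [Formula.word, List.cons_append, List.cons.injEq, reduceCtorEq,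
      Sum.inr.injEq, Sum.inl.injEq, false_and, List.nil_append, true_and,
      List.append_assoc] at h
    obtain ⟨rfl, h'⟩ := ih₁ _ _ _ h
    obtain ⟨rfl, rfl⟩ := ih₂ _ _ _ h'
    exact ⟨rfl, rfl⟩
  | K i φ ih =>
    intro ψ x y h
    cases ψ <;> simp only [Formula.word, List.cons_append, List.cons.injEq, reduceCtorEq,
      Sum.inr.injEq, Sum.inl.injEq, false_and, List.nil_append] at h
    obtain ⟨rfl, h'⟩ := h
    obtain ⟨rfl, rfl⟩ := ih _ _ _ h'
    exact ⟨rfl, rfl⟩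
  | A i φ ih =>
    intro ψ x y h
    cases ψ <;> simp only [Formula.word, List.cons_append, List.cons.injEq, reduceCtorEq,
      Sum.inr.injEq, false_and, List.nil_append] at h
    obtain ⟨rfl, h'⟩ := h
    obtain ⟨rfl, rfl⟩ := ih _ _ _ h'
    exact ⟨rfl, rfl⟩

/-- Distinct formulas are distinct strings. -/
theorem Formula.word_injective {J : Type v} :
    Function.Injective (Formula.word : Formula J → List (Alphabet J)) := fun φ ψ h =>
  (φ.word_append_inj ψ [] [] (by rw [h])).1

/-- A set of formulas is decidable if there is an algorithm (a total recursive function) which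
decides, given any string over the alphabet, whether it is a formula belonging to the set. -/
def DecidableSet {J : Type v} [Primcodable J] (S : Set (Formula J)) : Prop :=
  ComputablePred fun x : List (Alphabet J) => ∃ φ ∈ S, φ.word = x

end Unawareness

open Unawareness

/-! Take a truth assignment at each state to the formulas of a subformula-closed set `C`, and read
relations off it: `τ` is accessible from `σ` if every `K i χ` in `C` true at `σ` stays true at `τ`;
`ρ` and `τ` are alike at `σ` if they agree on each `χ` with `A i χ` in `C` true at `σ`. This always
gives a partitional model, and an assignment that obeys the semantic clauses for these relations is
truth in that model (`Coherent.mem_interp`). Coherence depends only on which assignments to `C`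
occur (`Coherent.transfer`), so for finite `C` finitely many states suffice.

Maximal consistent theories are coherent (`coherent_theory`). For `K` this is the usual S4 argument.
For `A`, the sets of theories expressed by formulas of which a given theory is aware form a Boolean
algebra, by A-N, A-Neg and A-M. It contains every union of cells of a partition generated by
finitely many members (`mem_of_saturated`), and A-RE passes awareness to every formula expressing
the same set. One theory for each assignment to the subformulas of an underivable formula then gives
a finite countermodel, hence completeness.

Decidability bypasses the calculus. Truth in any partitional model is coherent, so validity means
truth throughout every coherent finite set of assignments to the subformulas
(`mem_logic_iff_nodeCoherent`), which is a bounded search. -/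

namespace Unawareness

/-! ### Subformulas -/

namespace Formula

variable {I : Type u}

/-- The list of subformulas of a formula. -/
def subs : Formula I → List (Formula I)
  | letter n => [letter n]
  | neg φ => neg φ :: φ.subs
  | and φ ψ => and φ ψ :: (φ.subs ++ ψ.subs)
  | K i φ => K i φ :: φ.subs
  | A i φ => A i φ :: φ.subs

theorem mem_subs_self (φ : Formula I) : φ ∈ φ.subs := by
  cases φ <;> simp [subs]

theorem subs_subset {φ ψ : Formula I} (h : ψ ∈ φ.subs) : ψ.subs ⊆ φ.subs := by
  induction φ with
  | letter n => simp only [subs, List.mem_singleton] at h; subst h; simp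
  | neg φ ih =>
    rcases List.mem_cons.1 h with rfl | h
    · simp
    · exact fun χ hχ => List.mem_cons_of_mem _ (ih h hχ)
  | and φ₁ φ₂ ih₁ ih₂ =>
    rcases List.mem_cons.1 h with rfl | h
    · simp
    · rcases List.mem_append.1 h with h | h
      · exact fun χ hχ => List.mem_cons_of_mem _ (List.mem_append_left _ (ih₁ h hχ))
      · exact fun χ hχ => List.mem_cons_of_mem _ (List.mem_append_right _ (ih₂ h hχ))
  | K i φ ih =>
    rcases List.mem_cons.1 h with rfl | h
    · simp
    · exact fun χ hχ => List.mem_cons_of_mem _ (ih h hχ)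
  | A i φ ih =>
    rcases List.mem_cons.1 h with rfl | h
    · simp
    · exact fun χ hχ => List.mem_cons_of_mem _ (ih h hχ)

/-- A set of formulas closed under immediate subformulas. -/
structure SubClosed (C : Set (Formula I)) : Prop where
  neg : ∀ {φ}, Formula.neg φ ∈ C → φ ∈ C
  and_left : ∀ {φ ψ}, Formula.and φ ψ ∈ C → φ ∈ C
  and_right : ∀ {φ ψ}, Formula.and φ ψ ∈ C → ψ ∈ C
  K : ∀ {i φ}, Formula.K i φ ∈ C → φ ∈ C
  A : ∀ {i φ}, Formula.A i φ ∈ C → φ ∈ C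

theorem subClosed_subs (φ : Formula I) : SubClosed {ψ | ψ ∈ φ.subs} where
  neg h := subs_subset h (by simp [subs, mem_subs_self])
  and_left h := subs_subset h (by simp [subs, mem_subs_self])
  and_right h := subs_subset h (by simp [subs, mem_subs_self])
  K h := subs_subset h (by simp [subs, mem_subs_self])
  A h := subs_subset h (by simp [subs, mem_subs_self])

end Formula

open Formula

/-! ### Coherent assignments -/

section Coherent

variable {I : Type u} {Ω : Type w} {Ω' : Type v}

/-- The accessibility relation of agent `i` read off from an assignment `t` of truth values to
the formulas in `C`. -/
def Access (C : Set (Formula I)) (t : Ω → Formula I → Prop) (i : I) (σ τ : Ω) : Prop :=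
  ∀ χ, K i χ ∈ C → t σ (K i χ) → t τ (K i χ)

/-- The equivalence relation of agent `i` at `σ` read off from an assignment `t` of truth values
to the formulas in `C`. -/
def Alike (C : Set (Formula I)) (t : Ω → Formula I → Prop) (i : I) (σ ρ τ : Ω) : Prop :=
  ∀ χ, A i χ ∈ C → t σ (A i χ) → (t ρ χ ↔ t τ χ)

/-- An assignment of truth values to the formulas in `C` at each state which satisfies the
semantic clauses for the relations read off from it. -/
structure Coherent (C : Set (Formula I)) (t : Ω → Formula I → Prop) : Prop where
  neg : ∀ σ φ, Formula.neg φ ∈ C → (t σ (Formula.neg φ) ↔ ¬ t σ φ)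
  and : ∀ σ φ ψ, Formula.and φ ψ ∈ C → (t σ (Formula.and φ ψ) ↔ t σ φ ∧ t σ ψ)
  K : ∀ σ i φ, Formula.K i φ ∈ C → (t σ (Formula.K i φ) ↔ ∀ τ, Access C t i σ τ → t τ φ)
  A : ∀ σ i φ, Formula.A i φ ∈ C →
    (t σ (Formula.A i φ) ↔ ∀ ρ τ, Alike C t i σ ρ τ → (t ρ φ ↔ t τ φ))

/-- The partitional model read off from an assignment of truth values. -/
def modelOf (C : Set (Formula I)) (t : Ω → Formula I → Prop) : PartitionalModel I Ω where
  -- Because `Access` preserves the formulas `K i χ` themselves, not just `χ`, it is a preorder for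
  -- every `t`, coherent or not.
  R := Access C t
  refl _ _ _ _ h := h
  trans _ _ _ _ h₁ h₂ χ hχ h := h₂ χ hχ (h₁ χ hχ h)
  approx i σ :=
    { r := Alike C t i σ
      iseqv :=
        { refl := fun _ _ _ _ => Iff.rfl
          symm := fun h χ hχ hσ => (h χ hχ hσ).symm
          trans := fun h₁ h₂ χ hχ hσ => (h₁ χ hχ hσ).trans (h₂ χ hχ hσ) } }

/-- The truth lemma: the coherence clauses are the semantic clauses of `modelOf C t`, so induction
on the formula applies. -/
theorem Coherent.mem_interp {C : Set (Formula I)} (hC : SubClosed C)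
    {t : Ω → Formula I → Prop} (ht : Coherent C t) {φ : Formula I} (hφ : φ ∈ C) (σ : Ω) :
    σ ∈ (modelOf C t).toStandard.interp (fun n => {σ | t σ (letter n)}) φ ↔ t σ φ := by
  induction φ generalizing σ with
  | letter n => rfl
  | neg φ ih =>
    rw [ht.neg σ φ hφ, ← ih (hC.neg hφ)]; rfl
  | and φ ψ ih₁ ih₂ =>
    rw [ht.and σ φ ψ hφ, ← ih₁ (hC.and_left hφ), ← ih₂ (hC.and_right hφ)]; rfl
  | K i φ ih =>
    rw [ht.K σ i φ hφ]
    exact forall_congr' fun τ => imp_congr Iff.rfl (ih (hC.K hφ) τ)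
  | A i φ ih =>
    rw [ht.A σ i φ hφ]
    exact forall_congr' fun ρ => forall_congr' fun τ =>
      imp_congr Iff.rfl (iff_congr (ih (hC.A hφ) ρ) (ih (hC.A hφ) τ))

theorem Coherent.not_valid {C : Set (Formula I)} (hC : SubClosed C)
    {t : Ω → Formula I → Prop} (ht : Coherent C t) {φ : Formula I} (hφ : φ ∈ C) {σ : Ω}
    (h : ¬ t σ φ) : ¬ (modelOf C t).Valid φ := fun hv =>
  h ((ht.mem_interp hC hφ σ).1 (hv _ ▸ Set.mem_univ σ))

/-- Truth in a partitional model is coherent. -/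
theorem PartitionalModel.coherent (M : PartitionalModel I Ω) (val : ℕ → Set Ω)
    (C : Set (Formula I)) : Coherent C fun σ φ => σ ∈ M.toStandard.interp val φ where
  neg _ _ _ := Iff.rfl
  and _ _ _ _ := Iff.rfl
  -- The relations read off from truth contain those of `M`: for `R` this is transitivity. The extra
  -- pairs do no harm: `K i φ` itself is carried to `τ`, and reflexivity yields `φ` there.
  K σ i φ hφ := by
    constructor
    · intro h τ hτ
      exact hτ φ hφ h (M.refl i τ)
    · intro h τ hτ
      exact h τ fun χ _ hχ ρ hρ => hχ (M.trans i σ τ ρ hτ hρ)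
  A σ i φ hφ := by
    constructor
    · intro h ρ τ hρτ
      exact hρτ φ hφ h
    · intro h ρ τ hρτ
      exact h ρ τ fun χ _ hχ => hχ ρ τ hρτ

/-- Coherence only depends on which truth assignments to the formulas in `C` occur. -/
theorem Coherent.transfer {C : Set (Formula I)} (hC : SubClosed C)
    {t : Ω → Formula I → Prop} {t' : Ω' → Formula I → Prop} (ht : Coherent C t)
    (h₁ : ∀ σ, ∃ σ', ∀ φ ∈ C, (t σ φ ↔ t' σ' φ))
    (h₂ : ∀ σ', ∃ σ, ∀ φ ∈ C, (t σ φ ↔ t' σ' φ)) : Coherent C t' where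
  neg σ' φ hφ := by
    obtain ⟨σ, h⟩ := h₂ σ'
    rw [← h _ hφ, ← h _ (hC.neg hφ), ht.neg σ φ hφ]
  and σ' φ ψ hφ := by
    obtain ⟨σ, h⟩ := h₂ σ'
    rw [← h _ hφ, ← h _ (hC.and_left hφ), ← h _ (hC.and_right hφ), ht.and σ φ ψ hφ]
  K σ' i φ hφ := by
    obtain ⟨σ, h⟩ := h₂ σ'
    rw [← h _ hφ, ht.K σ i φ hφ]
    constructor
    · intro H τ' hτ'
      obtain ⟨τ, k⟩ := h₂ τ'
      refine (k _ (hC.K hφ)).1 (H τ fun χ hχ hσ => ?_)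
      exact (k _ hχ).2 (hτ' χ hχ ((h _ hχ).1 hσ))
    -- Quantifiers over `Ω` are moved to `Ω'`, which needs every assignment on `Ω` to occur on `Ω'`.
    · intro H τ hτ
      obtain ⟨τ', k⟩ := h₁ τ
      refine (k _ (hC.K hφ)).2 (H τ' fun χ hχ hσ => ?_)
      exact (k _ hχ).1 (hτ χ hχ ((h _ hχ).2 hσ))
  A σ' i φ hφ := by
    obtain ⟨σ, h⟩ := h₂ σ'
    rw [← h _ hφ, ht.A σ i φ hφ]
    constructor
    · intro H ρ' τ' hτ'
      obtain ⟨τ, k⟩ := h₂ τ'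
      obtain ⟨ρ, l⟩ := h₂ ρ'
      rw [← k _ (hC.A hφ), ← l _ (hC.A hφ)]
      refine H ρ τ fun χ hχ hσ => ?_
      rw [k _ (hC.A hχ), l _ (hC.A hχ)]
      exact hτ' χ hχ ((h _ hχ).1 hσ)
    · intro H ρ τ hτ
      obtain ⟨τ', k⟩ := h₁ τ
      obtain ⟨ρ', l⟩ := h₁ ρ
      rw [k _ (hC.A hφ), l _ (hC.A hφ)]
      refine H ρ' τ' fun χ hχ hσ => ?_
      rw [← k _ (hC.A hχ), ← l _ (hC.A hχ)]
      exact hτ χ hχ ((h _ hχ).2 hσ)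

end Coherent

/-! ### Soundness -/

section Soundness

variable {I : Type u} {Ω : Type w}

theorem StandardModel.mem_interp_imp (M : StandardModel I Ω) (val : ℕ → Set Ω)
    (φ ψ : Formula I) (σ : Ω) :
    σ ∈ M.interp val (φ.imp ψ) ↔ (σ ∈ M.interp val φ → σ ∈ M.interp val ψ) := by
  simp [Formula.imp, StandardModel.interp]

theorem StandardModel.mem_interp_iff (M : StandardModel I Ω) (val : ℕ → Set Ω)
    (φ ψ : Formula I) (σ : Ω) :
    σ ∈ M.interp val (φ.iff ψ) ↔ (σ ∈ M.interp val φ ↔ σ ∈ M.interp val ψ) := by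
  rw [iff_iff_implies_and_implies (a := σ ∈ M.interp val φ), ← mem_interp_imp, ← mem_interp_imp]
  rfl

theorem StandardModel.mem_interp_subst (M : StandardModel I Ω) (val : ℕ → Set Ω)
    (p : PropFormula) (s : ℕ → Formula I) (σ : Ω) [∀ n, Decidable (σ ∈ M.interp val (s n))] :
    σ ∈ M.interp val (p.subst s) ↔ p.eval (fun n => decide (σ ∈ M.interp val (s n))) = true := by
  induction p with
  | var n => simp [PropFormula.subst, PropFormula.eval]
  | neg p ih => simp [PropFormula.subst, PropFormula.eval, StandardModel.interp, ih]
  | and p q ihp ihq => simp [PropFormula.subst, PropFormula.eval, StandardModel.interp, ihp, ihq]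

theorem Derivable.mem_interp {φ : Formula I} (h : Derivable φ) (M : PartitionalModel I Ω)
    (val : ℕ → Set Ω) (σ : Ω) : σ ∈ M.toStandard.interp val φ := by
  classical
  induction h generalizing σ with
  | pl p s hp => exact (StandardModel.mem_interp_subst _ _ _ _ _).2 (hp _)
  | k_k i φ ψ =>
    simp only [StandardModel.mem_interp_imp]
    intro h₁ h₂ τ hτ
    exact (StandardModel.mem_interp_imp _ _ _ _ _).1 (h₁ hτ) (h₂ hτ)
  | k_t i φ =>
    simp only [StandardModel.mem_interp_imp]
    intro h
    exact h (M.refl i σ)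
  | k_4 i φ =>
    simp only [StandardModel.mem_interp_imp]
    intro h τ hτ ρ hρ
    exact h (M.trans i σ τ ρ hτ hρ)
  | a_neg i φ =>
    simp only [StandardModel.mem_interp_imp]
    intro h ρ τ hρτ
    exact not_congr (h ρ τ hρτ)
  | a_m i φ ψ =>
    simp only [StandardModel.mem_interp_imp]
    intro h ρ τ hρτ
    exact and_congr (h.1 ρ τ hρτ) (h.2 ρ τ hρτ)
  | a_n i =>
    intro ρ τ _
    simp [Formula.top, StandardModel.interp]
  | mp φ ψ _ _ ih₁ ih₂ => exact (StandardModel.mem_interp_imp _ _ _ _ _).1 (ih₂ σ) (ih₁ σ)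
  | k_rn i φ _ ih => exact fun τ _ => ih τ
  | a_re i φ ψ _ ih =>
    -- The induction hypothesis holds at all states, so the two formulas express the same event, and
    -- `A` acts on events.
    have : M.toStandard.interp val φ = M.toStandard.interp val ψ :=
      Set.ext fun τ => (StandardModel.mem_interp_iff _ _ _ _ _).1 (ih τ)
    rw [StandardModel.mem_interp_iff]
    simp only [StandardModel.interp, this]

end Soundness

/-! ### Boolean valuations -/

section Completeness

variable {I : Type u}

/-- A truth value assignment to all formulas which respects the Boolean connectives. -/
def IsBoolean (h : Formula I → Bool) : Prop :=
  (∀ φ, h (neg φ) = !h φ) ∧ ∀ φ ψ, h (and φ ψ) = (h φ && h ψ)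

theorem IsBoolean.imp {h : Formula I → Bool} (hh : IsBoolean h) (φ ψ : Formula I) :
    h (φ.imp ψ) = (!h φ || h ψ) := by
  simp [Formula.imp, hh.1, hh.2]

theorem IsBoolean.iff {h : Formula I → Bool} (hh : IsBoolean h) (φ ψ : Formula I) :
    h (φ.iff ψ) = (h φ == h ψ) := by
  simp only [Formula.iff, hh.2, hh.imp]
  cases h φ <;> cases h ψ <;> rfl

theorem IsBoolean.top {h : Formula I → Bool} (hh : IsBoolean h) : h top = true := by
  simp [Formula.top, hh.1, hh.2]

open Classical in
/-- The propositional skeleton of a formula; letters and modal formulas become variables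
according to their position in `L`. -/
noncomputable def skeleton (L : List (Formula I)) : Formula I → PropFormula
  | neg φ => .neg (skeleton L φ)
  | .and φ ψ => .and (skeleton L φ) (skeleton L ψ)
  | φ => .var (L.idxOf φ)

/-- Lookup by position undoes `idxOf` on members of `L`; the default `top` is never reached. -/
theorem subst_skeleton (L : List (Formula I)) (φ : Formula I) (h : φ.subs ⊆ L) :
    (skeleton L φ).subst (fun n => L.getD n top) = φ := by
  classical
  have key : ∀ ψ : Formula I, ψ ∈ L → L.getD (L.idxOf ψ) top = ψ := fun ψ hψ => by
    rw [List.getD_eq_getElem _ _ (List.idxOf_lt_length_of_mem hψ), List.getElem_idxOf]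
  induction φ with
  | letter n => exact key _ (h (mem_subs_self _))
  | neg φ ih =>
    simp only [skeleton, PropFormula.subst]
    rw [ih fun ψ hψ => h (List.mem_cons_of_mem _ hψ)]
  | and φ ψ ih₁ ih₂ =>
    simp only [skeleton, PropFormula.subst]
    rw [ih₁ fun ψ hψ => h (List.mem_cons_of_mem _ (List.mem_append_left _ hψ)),
      ih₂ fun ψ hψ => h (List.mem_cons_of_mem _ (List.mem_append_right _ hψ))]
  | K i φ _ => exact key _ (h (mem_subs_self _))
  | A i φ _ => exact key _ (h (mem_subs_self _))

/-- Evaluating skeletons under a fixed `t` is itself a Boolean assignment, so the skeleton of `φ` is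
a tautology. -/
theorem Derivable.of_forall_isBoolean {φ : Formula I} (h : ∀ b, IsBoolean b → b φ = true) :
    Derivable φ := by
  rw [← subst_skeleton φ.subs φ (List.Subset.refl _)]
  exact .pl _ _ fun t => h (fun ψ => (skeleton φ.subs ψ).eval t) ⟨fun _ => rfl, fun _ _ => rfl⟩

theorem Derivable.of_list {F : List (Formula I)} (hF : ∀ ψ ∈ F, Derivable ψ) {φ : Formula I}
    (h : ∀ b, IsBoolean b → (∀ ψ ∈ F, b ψ = true) → b φ = true) : Derivable φ := by
  induction F generalizing φ with
  | nil => exact .of_forall_isBoolean fun b hb => h b hb (by simp)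
  | cons ψ F ih =>
    refine .mp ψ φ (hF ψ (by simp)) (ih (fun χ hχ => hF χ (by simp [hχ])) fun b hb hbF => ?_)
    rw [hb.imp]
    cases hψ : b ψ
    · rfl
    · exact h b hb (by simpa [hψ] using hbF)

/-! ### Maximal consistent theories -/

/-- The maximal consistent theories: Boolean truth value assignments which make all derivable
formulas true. -/
abbrev Theory (I : Type u) : Type u :=
  {b : Formula I → Bool // IsBoolean b ∧ ∀ φ, Derivable φ → b φ = true}

/-- Lindenbaum's lemma by compactness of the product space `Formula I → Bool`, which works for any
number of agents. -/
theorem exists_theory_of_not_derivable {φ : Formula I} (h : ¬ Derivable φ) :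
    ∃ b : Theory I, b.1 φ = false := by
  let B : Set (Formula I → Bool) := {b | IsBoolean b ∧ b φ = false}
  have hB : IsClosed B := by
    have : B = ((⋂ ψ, {b | b (neg ψ) = !b ψ}) ∩
        ⋂ ψ, ⋂ χ, {b | b (and ψ χ) = (b ψ && b χ)}) ∩ {b | b φ = false} := by
      ext b; simp [B, IsBoolean]
    rw [this]
    refine ((isClosed_iInter fun ψ => ?_).inter
      (isClosed_iInter fun ψ => isClosed_iInter fun χ => ?_)).inter ?_
    · exact isClosed_eq (continuous_apply _) ((continuous_of_discreteTopology (f := Bool.not)).comp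
        (continuous_apply ψ : Continuous fun b : Formula I → Bool => b ψ))
    · exact isClosed_eq (continuous_apply _)
        ((continuous_of_discreteTopology (f := fun p : Bool × Bool => p.1 && p.2)).comp
          ((continuous_apply ψ : Continuous fun b : Formula I → Bool => b ψ).prodMk
            (continuous_apply χ)))
    · exact isClosed_eq (continuous_apply _) continuous_const
  obtain ⟨b, hb, hb'⟩ := hB.isCompact.inter_iInter_nonempty
    (fun ψ : {ψ : Formula I // Derivable ψ} => {b | b ψ.1 = true})
    -- Finite intersection property: if finitely many derivable formulas could not be true together
    -- with `φ` false, `φ` would follow from them propositionally.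
    (fun ψ => isClosed_eq (continuous_apply _) continuous_const) (fun F => by
      by_contra hF
      refine h (.of_list (F := (F.toList.map Subtype.val)) ?_ fun b hb hbF => ?_)
      · intro ψ hψ
        obtain ⟨χ, -, rfl⟩ := List.mem_map.1 hψ
        exact χ.2
      · by_contra hφ
        refine hF ⟨b, ⟨hb, by simpa using hφ⟩, ?_⟩
        simp only [Set.mem_iInter, Set.mem_ofPred_eq]
        exact fun ψ hψ => hbF _ (List.mem_map.2 ⟨ψ, by simpa using hψ, rfl⟩))
  exact ⟨⟨b, hb.1, fun ψ hψ => Set.mem_iInter.1 hb' ⟨ψ, hψ⟩⟩, hb.2⟩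

theorem derivable_of_forall_theory {φ : Formula I} (h : ∀ b : Theory I, b.1 φ = true) :
    Derivable φ := by
  by_contra hφ
  obtain ⟨b, hb⟩ := exists_theory_of_not_derivable hφ
  simp [h b] at hb

namespace Theory

theorem imp {b : Theory I} {φ ψ : Formula I} (h : Derivable (φ.imp ψ)) (hφ : b.1 φ = true) :
    b.1 ψ = true := by
  simpa [b.2.1.imp, hφ] using b.2.2 _ h

theorem K_mp {b : Theory I} {i : I} {φ ψ : Formula I} (h : b.1 (K i (φ.imp ψ)) = true)
    (hφ : b.1 (K i φ) = true) : b.1 (K i ψ) = true := by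
  simpa [b.2.1.imp, hφ] using imp (.k_k i φ ψ) h

/-- The premises in `L` are discharged one at a time by K-K; with none left, `φ` lies in every
theory, so it is derivable and K-RN applies. -/
theorem K_of_forall {b : Theory I} {i : I} {L : List (Formula I)}
    (hL : ∀ χ ∈ L, b.1 (K i χ) = true) {φ : Formula I}
    (h : ∀ b' : Theory I, (∀ χ ∈ L, b'.1 χ = true) → b'.1 φ = true) : b.1 (K i φ) = true := by
  induction L generalizing φ with
  | nil => exact b.2.2 _ (.k_rn i φ (derivable_of_forall_theory fun b' => h b' (by simp)))
  | cons χ L ih =>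
    refine K_mp (φ := χ) (ih (fun ψ hψ => hL ψ (by simp [hψ])) fun b' hb' => ?_) (hL χ (by simp))
    rw [b'.2.1.imp]
    cases hχ : b'.1 χ
    · rfl
    · exact h b' (by simpa [hχ] using hb')

end Theory

/-! ### Awareness and the canonical model -/

/-- A family of sets closed under the Boolean operations contains every set that is a union of
cells of the partition generated by finitely many of its members. -/
theorem mem_of_saturated {X : Type*} {D : Set (Set X)} (huniv : Set.univ ∈ D)
    (hcompl : ∀ E ∈ D, Eᶜ ∈ D) (hinter : ∀ E ∈ D, ∀ F ∈ D, E ∩ F ∈ D) {L : List (Set X)}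
    (hL : ∀ F ∈ L, F ∈ D) {E : Set X}
    (hE : ∀ x y, (∀ F ∈ L, (x ∈ F ↔ y ∈ F)) → (x ∈ E ↔ y ∈ E)) : E ∈ D := by
  have hunion : ∀ E ∈ D, ∀ F ∈ D, E ∪ F ∈ D := fun E hE F hF => by
    rw [← compl_compl (E ∪ F), Set.compl_union]
    exact hcompl _ (hinter _ (hcompl _ hE) _ (hcompl _ hF))
  induction L generalizing E with
  | nil =>
    rcases E.eq_empty_or_nonempty with rfl | ⟨x, hx⟩
    · simpa using hcompl _ huniv
    · rwa [Set.eq_univ_of_forall fun y => (hE x y (by simp)).1 hx]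
  | cons F L ih =>
    -- The least superset of `G` that is a union of cells for `L`.
    let sat : Set X → Set X := fun G => {x | ∃ y ∈ G, ∀ H ∈ L, (y ∈ H ↔ x ∈ H)}
    have hsat : ∀ G, sat G ∈ D := fun G => ih (fun H hH => hL H (by simp [hH])) fun x y hxy =>
      ⟨fun ⟨z, hz, hzx⟩ => ⟨z, hz, fun H hH => (hzx H hH).trans (hxy H hH)⟩,
        fun ⟨z, hz, hzy⟩ => ⟨z, hz, fun H hH => (hzy H hH).trans (hxy H hH).symm⟩⟩
    have hF : F ∈ D := hL F (by simp)
    -- Points of `F` that agree on `L` agree on `F :: L`, so saturating `E ∩ F` under `L` adds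
    -- nothing to `E` within `F`; likewise for `Fᶜ`.
    have : E = (sat (E ∩ F) ∩ F) ∪ (sat (E ∩ Fᶜ) ∩ Fᶜ) := by
      ext x
      constructor
      · intro hx
        by_cases hxF : x ∈ F
        · exact Or.inl ⟨⟨x, ⟨hx, hxF⟩, fun _ _ => Iff.rfl⟩, hxF⟩
        · exact Or.inr ⟨⟨x, ⟨hx, hxF⟩, fun _ _ => Iff.rfl⟩, hxF⟩
      · rintro (⟨⟨y, ⟨hy, hyF⟩, hyx⟩, hxF⟩ | ⟨⟨y, ⟨hy, hyF⟩, hyx⟩, hxF⟩)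
        · exact (hE y x (by simpa [hyF, hxF] using hyx)).1 hy
        · refine (hE y x ?_).1 hy
          simp only [List.mem_cons, forall_eq_or_imp]
          exact ⟨iff_of_false hyF hxF, hyx⟩
    rw [this]
    exact hunion _ (hinter _ (hsat _) _ hF) _ (hinter _ (hsat _) _ (hcompl _ hF))

/-- The extension of `φ` lies in the Boolean algebra of extensions of formulas of which `b` is
aware, so some such `χ` has the same extension. Then `χ` and `φ` are provably equivalent, and A-RE
applies. -/
theorem Theory.A_of_forall {b : Theory I} {i : I} {L : List (Formula I)}
    (hL : ∀ χ ∈ L, b.1 (A i χ) = true) {φ : Formula I}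
    (h : ∀ c d : Theory I, (∀ χ ∈ L, (c.1 χ = true ↔ d.1 χ = true)) →
      (c.1 φ = true ↔ d.1 φ = true)) : b.1 (A i φ) = true := by
  let ext : Formula I → Set (Theory I) := fun χ => {c | c.1 χ = true}
  have key : ext φ ∈ {E | ∃ χ, ext χ = E ∧ b.1 (A i χ) = true} := by
    refine mem_of_saturated (L := L.map ext) ?_ ?_ ?_ ?_ ?_
    · exact ⟨Formula.top, Set.eq_univ_of_forall fun c => c.2.1.top, b.2.2 _ (.a_n i)⟩
    · rintro _ ⟨χ, rfl, hχ⟩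
      refine ⟨χ.neg, ?_, imp (.a_neg i χ) hχ⟩
      ext c; simp [ext, c.2.1.1]
    · rintro _ ⟨χ, rfl, hχ⟩ _ ⟨ψ, rfl, hψ⟩
      refine ⟨χ.and ψ, ?_, imp (.a_m i χ ψ) (by simp [b.2.1.2, hχ, hψ])⟩
      ext c; simp [ext, c.2.1.2]
    · intro F hF
      obtain ⟨χ, hχ, rfl⟩ := List.mem_map.1 hF
      exact ⟨χ, rfl, hL χ hχ⟩
    · intro c d hcd
      exact h c d fun χ hχ => hcd (ext χ) (List.mem_map_of_mem hχ)
  obtain ⟨χ, hχφ, hχ⟩ := key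
  have hd : Derivable ((A i χ).iff (A i φ)) := by
    refine .a_re i χ φ (derivable_of_forall_theory fun c => ?_)
    have := Set.ext_iff.1 hχφ c
    simpa [c.2.1.iff, ext, ← Bool.eq_iff_iff] using this
  simpa [b.2.1.iff, hχ] using b.2.2 _ hd

/-- Membership in maximal consistent theories is coherent for every finite set of formulas. -/
theorem coherent_theory (L : List (Formula I)) :
    Coherent {φ | φ ∈ L} fun (b : Theory I) φ => b.1 φ = true where
  neg b φ _ := by simp [b.2.1.1]
  and b φ ψ _ := by simp [b.2.1.2]
  K b i φ hφ := by
    classical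
    constructor
    · exact fun h c hc => Theory.imp (.k_t i φ) (hc φ hφ h)
    · intro h
      -- The premises are the formulas `K i χ` true at `b`, as `Access` requires; K-4 puts a further
      -- `K i` in front of them.
      refine Theory.K_of_forall (L := L.filter fun ψ => ∃ χ, ψ = K i χ ∧ b.1 ψ = true) ?_ ?_
      · intro ψ hψ
        simp only [List.mem_filter, decide_eq_true_eq] at hψ
        obtain ⟨-, χ, rfl, hχ⟩ := hψ
        exact Theory.imp (.k_4 i χ) hχ
      · intro c hc
        refine h c fun χ hχ hb => hc _ ?_
        simp only [List.mem_filter, decide_eq_true_eq]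
        exact ⟨hχ, χ, rfl, hb⟩
  A b i φ hφ := by
    classical
    constructor
    · exact fun h c d hcd => hcd φ hφ h
    · intro h
      let f : Formula I → List (Formula I) := fun ψ =>
        match ψ with
        | A j χ => if j = i ∧ b.1 ψ = true then [χ] else []
        | _ => []
      refine Theory.A_of_forall (L := L.flatMap f) ?_ ?_
      · intro χ hχ
        obtain ⟨ψ, -, hψ⟩ := List.mem_flatMap.1 hχ
        cases ψ with
        | A j ξ =>
          simp only [f] at hψ
          split_ifs at hψ with hj
          · obtain ⟨rfl, hj⟩ := hj
            rwa [List.mem_singleton.1 hψ]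
          · simp at hψ
        | _ => simp [f] at hψ
      · intro c d hcd
        refine h c d fun χ hχ hb => hcd _ (List.mem_flatMap.2 ⟨_, hχ, ?_⟩)
        simp [f, hb]

/-! ### Finite countermodels and completeness -/

/-- Finitely many theories represent all theories as far as the formulas in a finite list are
concerned. -/
theorem exists_representatives (L : List (Formula I)) :
    ∃ (n : ℕ) (r : Fin n → Theory I), ∀ b : Theory I, ∃ k, ∀ φ ∈ L, b.1 φ = (r k).1 φ := by
  let f : Theory I → ({φ // φ ∈ L} → Bool) := fun b φ => b.1 φ.1
  have : Finite {φ // φ ∈ L} := L.finite_toSet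
  obtain ⟨n, ⟨e⟩⟩ := Finite.exists_equiv_fin (Set.range f)
  choose g hg using fun y : Set.range f => y.2
  refine ⟨n, fun k => g (e.symm k), fun b => ⟨e ⟨f b, b, rfl⟩, fun φ hφ => ?_⟩⟩
  have := congrFun (hg ⟨f b, b, rfl⟩) ⟨φ, hφ⟩
  simpa [f] using this.symm

/-- A formula that is not derivable can be refuted on any state space whose states represent
enough theories. -/
theorem exists_not_valid {φ : Formula I} (h : ¬ Derivable φ) {Ω : Type w} (r : Ω → Theory I)
    (hr : ∀ b : Theory I, ∃ k, ∀ ψ ∈ φ.subs, b.1 ψ = (r k).1 ψ) :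
    ∃ M : PartitionalModel I Ω, ¬ M.Valid φ := by
  obtain ⟨b, hb⟩ := exists_theory_of_not_derivable h
  obtain ⟨k, hk⟩ := hr b
  have hc := (coherent_theory φ.subs).transfer (subClosed_subs φ)
    (t' := fun k ψ => (r k).1 ψ = true)
    (fun b => (hr b).imp fun k hk ψ hψ => by rw [hk ψ hψ]) (fun k => ⟨r k, fun _ _ => Iff.rfl⟩)
  exact ⟨_, hc.not_valid (subClosed_subs φ) (mem_subs_self φ) (σ := k)
    (by simp [← hk _ (mem_subs_self φ), hb])⟩

theorem exists_finite_not_valid {φ : Formula I} (h : ¬ Derivable φ) :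
    ∃ (n : ℕ) (M : PartitionalModel I (Fin n)), ¬ M.Valid φ := by
  obtain ⟨n, r, hr⟩ := exists_representatives φ.subs
  exact ⟨n, exists_not_valid h r hr⟩

theorem mem_logic_iff_derivable (φ : Formula I) : φ ∈ logic.{u, w} I ↔ Derivable φ := by
  constructor
  · intro hφ
    by_contra h
    obtain ⟨n, r, hr⟩ := exists_representatives φ.subs
    -- `ULift` moves the finite state space into the universe over which `logic` quantifies.
    obtain ⟨M, hM⟩ := exists_not_valid h (Ω := ULift.{w} (Fin n)) (fun k => r k.down)
      fun b => (hr b).imp' ULift.up fun _ => id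
    exact hM (hφ _ M)
  · exact fun h Ω M val => Set.eq_univ_of_forall (h.mem_interp M val)

end Completeness

/-! ### Renaming of agents -/

section Renaming

variable {I : Type u} {J : Type v}

theorem StandardModel.interp_map {Ω : Type w} (e : J → I) (M : StandardModel I Ω)
    (val : ℕ → Set Ω) (φ : Formula J) :
    M.interp val (φ.map e) =
      StandardModel.interp ⟨fun j => M.k (e j), fun j => M.a (e j)⟩ val φ := by
  induction φ with
  | letter n => rfl
  | neg φ ih => simp only [Formula.map, interp, ih]
  | and φ ψ ih₁ ih₂ => simp only [Formula.map, interp, ih₁, ih₂]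
  | K i φ ih => simp only [Formula.map, interp, ih]
  | A i φ ih => simp only [Formula.map, interp, ih]

/-- A model for `I` restricts along `e`; a model for `J` extends to `I`, with total relations for
agents outside the range of `e`. -/
theorem map_mem_logic_iff (e : J ↪ I) (φ : Formula J) :
    φ.map e ∈ logic.{u, w} I ↔ φ ∈ logic.{v, w} J := by
  classical
  constructor
  · intro h Ω M val
    let N : PartitionalModel I Ω :=
      { R := fun i σ τ => ∀ j, e j = i → M.R j σ τ
        refl := fun _ σ j _ => M.refl j σ
        trans := fun _ σ τ ρ h₁ h₂ j hj => M.trans j σ τ ρ (h₁ j hj) (h₂ j hj)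
        approx := fun i σ => if h : ∃ j, e j = i then M.approx h.choose σ else ⊤ }
    have hN := h Ω N val
    rw [StandardModel.interp_map] at hN
    rw [← hN]
    congr 1
    have hR : ∀ j, N.R (e j) = M.R j := fun j => by
      funext σ τ
      simp [N, e.injective.eq_iff]
    have hA : ∀ j σ ρ τ, N.approx (e j) σ ρ τ ↔ M.approx j σ ρ τ := fun j σ ρ τ => by
      have hj : ∃ k, e k = e j := ⟨j, rfl⟩
      have : N.approx (e j) σ = M.approx j σ := by
        simp only [N, dif_pos hj]
        rw [e.injective hj.choose_spec]
      rw [this]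
    simp only [PartitionalModel.toStandard, hR, hA]
  · intro h Ω M val
    rw [StandardModel.interp_map]
    exact h Ω ⟨fun j => M.R (e j), fun j => M.refl (e j), fun j => M.trans (e j),
      fun j => M.approx (e j)⟩ val

end Renaming

/-! ### Parsing -/

section Parsing

variable {J : Type v}

/-- The type of a symbol: letter, negation, conjunction, `K` or `A`. -/
def kind (s : Alphabet J) : ℕ :=
  s.elim (fun _ => 0) fun s => s.elim (fun b => bif b then 2 else 1)
    fun s => s.elim (fun _ => 3) fun _ => 4

/-- The number of arguments of a symbol. -/
def arity (s : Alphabet J) : ℕ :=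
  s.elim (fun _ => 0) fun s => s.elim (fun b => bif b then 2 else 1) fun _ => 1

/-- A symbol with the words that are its arguments. -/
abbrev Node (J : Type v) : Type v := Alphabet J × List (List (Alphabet J))

/-- The word represented by a node. -/
def Node.word (n : Node J) : List (Alphabet J) := n.1 :: n.2.flatten

/-- The main symbol of a formula with its arguments. -/
def Formula.node : Formula J → Node J
  | .letter n => (.inl n, [])
  | .neg φ => (.inr (.inl false), [φ.word])
  | .and φ ψ => (.inr (.inl true), [φ.word, ψ.word])
  | .K j φ => (.inr (.inr (.inl j)), [φ.word])
  | .A j φ => (.inr (.inr (.inr j)), [φ.word])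

theorem Formula.word_node (φ : Formula J) : φ.node.word = φ.word := by
  cases φ <;> simp [Formula.node, Formula.word, Node.word]

theorem Formula.length_node (φ : Formula J) : φ.node.2.length = arity φ.node.1 := by
  cases φ <;> rfl

/-- Reading a string from right to left with a stack: the resulting stack, and the nodes that
have been formed. -/
def parse (x : List (Alphabet J)) : List (List (Alphabet J)) × List (Node J) :=
  x.foldr (fun s p => ((s :: (p.1.take (arity s)).flatten) :: p.1.drop (arity s),
    (s, p.1.take (arity s)) :: p.2)) ([], [])

theorem parse_cons (s : Alphabet J) (x : List (Alphabet J)) :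
    parse (s :: x) = ((s :: ((parse x).1.take (arity s)).flatten) :: (parse x).1.drop (arity s),
      (s, (parse x).1.take (arity s)) :: (parse x).2) := rfl

/-- Reading from the right, a symbol finds its arguments already complete on top of the stack. -/
theorem parse_word_append (φ : Formula J) (x : List (Alphabet J)) :
    parse (φ.word ++ x) = (φ.word :: (parse x).1, φ.subs.map Formula.node ++ (parse x).2) := by
  induction φ generalizing x with
  | letter n => simp [Formula.word, Formula.subs, parse_cons, arity, Formula.node]
  | neg φ ih => simp [Formula.word, Formula.subs, parse_cons, arity, Formula.node, ih]
  | and φ ψ ih₁ ih₂ =>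
    simp [Formula.word, Formula.subs, parse_cons, arity, Formula.node, ih₁, ih₂]
  | K i φ ih => simp [Formula.word, Formula.subs, parse_cons, arity, Formula.node, ih]
  | A i φ ih => simp [Formula.word, Formula.subs, parse_cons, arity, Formula.node, ih]

theorem parse_word (φ : Formula J) : parse φ.word = ([φ.word], φ.subs.map Formula.node) := by
  simpa [parse] using parse_word_append φ []

theorem flatten_parse (x : List (Alphabet J)) : (parse x).1.flatten = x := by
  induction x with
  | nil => rfl
  | cons s x ih =>
    rw [parse_cons, List.flatten_cons, List.cons_append, ← List.flatten_append,
      List.take_append_drop, ih]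

/-- `take` returns too few arguments when the stack is too short; the length condition excludes
exactly this, so every stack entry is a formula. -/
theorem exists_formulas_of_parse (x : List (Alphabet J))
    (h : ∀ n ∈ (parse x).2, n.2.length = arity n.1) :
    ∃ L : List (Formula J), (parse x).1 = L.map Formula.word := by
  induction x with
  | nil => exact ⟨[], rfl⟩
  | cons s x ih =>
    rw [parse_cons] at h
    simp only [List.mem_cons, forall_eq_or_imp] at h
    obtain ⟨hs, hx⟩ := h
    obtain ⟨L, hL⟩ := ih hx
    rw [parse_cons, hL]
    rw [hL] at hs
    rcases s with n | (_ | _) | j | j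
    · exact ⟨letter n :: L, by simp [arity, Formula.word]⟩
    · rcases L with _ | ⟨φ, L⟩
      · simp [arity] at hs
      · exact ⟨neg φ :: L, by simp [arity, Formula.word]⟩
    · rcases L with _ | ⟨φ, _ | ⟨ψ, L⟩⟩
      · simp [arity] at hs
      · simp [arity] at hs
      · exact ⟨and φ ψ :: L, by simp [arity, Formula.word]⟩
    · rcases L with _ | ⟨φ, L⟩
      · simp [arity] at hs
      · exact ⟨K j φ :: L, by simp [arity, Formula.word]⟩
    · rcases L with _ | ⟨φ, L⟩
      · simp [arity] at hs
      · exact ⟨A j φ :: L, by simp [arity, Formula.word]⟩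

theorem exists_word_eq_iff (x : List (Alphabet J)) :
    (∃ φ : Formula J, φ.word = x) ↔
      (parse x).1.length = 1 ∧ ∀ n ∈ (parse x).2, n.2.length = arity n.1 := by
  constructor
  · rintro ⟨φ, rfl⟩
    rw [parse_word]
    refine ⟨rfl, fun n hn => ?_⟩
    obtain ⟨ψ, -, rfl⟩ := List.mem_map.1 hn
    exact ψ.length_node
  · rintro ⟨h₁, h₂⟩
    obtain ⟨L, hL⟩ := exists_formulas_of_parse x h₂
    have hx := flatten_parse x
    rw [hL, List.length_map] at h₁
    obtain ⟨φ, rfl⟩ := List.length_eq_one_iff.1 h₁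
    exact ⟨φ, by simpa [hL] using hx⟩

end Parsing

/-! ### The decision criterion -/

section Criterion

variable {J : Type v}

/-- The accessibility relation for the operator `s`, in terms of nodes. -/
def NodeAccess (N : List (Node J)) (s : Alphabet J) (t t' : List (List (Alphabet J))) : Prop :=
  ∀ n ∈ N, n.1 = s → n.word ∈ t → n.word ∈ t'

/-- The equivalence relation for the operator `s`, in terms of nodes. -/
def NodeAlike (N : List (Node J)) (s : Alphabet J) (t r r' : List (List (Alphabet J))) : Prop :=
  ∀ n ∈ N, n.1 = s → n.word ∈ t → ∀ x ∈ n.2, (x ∈ r ↔ x ∈ r')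

/-- Coherence of a finite set `S` of types, each given by the list of words that it makes true. -/
def NodeCoherent (N : List (Node J)) (S : List (List (List (Alphabet J)))) : Prop :=
  ∀ t ∈ S, ∀ n ∈ N,
    (kind n.1 = 1 → (n.word ∈ t ↔ ∀ x ∈ n.2, x ∉ t)) ∧
    (kind n.1 = 2 → (n.word ∈ t ↔ ∀ x ∈ n.2, x ∈ t)) ∧
    (kind n.1 = 3 → (n.word ∈ t ↔ ∀ t' ∈ S, NodeAccess N n.1 t t' → ∀ x ∈ n.2, x ∈ t')) ∧
    (kind n.1 = 4 → (n.word ∈ t ↔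
      ∀ r ∈ S, ∀ r' ∈ S, NodeAlike N n.1 t r r' → ∀ x ∈ n.2, (x ∈ r ↔ x ∈ r')))

theorem nodeAccess_iff (C : List (Formula J)) (S : List (List (List (Alphabet J)))) (j : J)
    (t t' : {t // t ∈ S}) :
    NodeAccess (C.map Formula.node) (.inr (.inr (.inl j))) t.1 t'.1 ↔
      Access {φ | φ ∈ C} (fun (t : {t // t ∈ S}) φ => φ.word ∈ t.1) j t t' := by
  simp only [NodeAccess, List.forall_mem_map, word_node]
  constructor
  · exact fun h χ hχ => h _ hχ rfl
  · intro h φ hφ hj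
    cases φ <;> simp only [Formula.node, reduceCtorEq, Sum.inr.injEq, Sum.inl.injEq] at hj
    subst hj
    exact h _ hφ

theorem nodeAlike_iff (C : List (Formula J)) (S : List (List (List (Alphabet J)))) (j : J)
    (t r r' : {t // t ∈ S}) :
    NodeAlike (C.map Formula.node) (.inr (.inr (.inr j))) t.1 r.1 r'.1 ↔
      Alike {φ | φ ∈ C} (fun (t : {t // t ∈ S}) φ => φ.word ∈ t.1) j t r r' := by
  simp only [NodeAlike, List.forall_mem_map, word_node]
  constructor
  · exact fun h χ hχ ht => h _ hχ rfl ht _ (by simp [Formula.node])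
  · intro h φ hφ hj
    cases φ <;> simp only [Formula.node, reduceCtorEq, Sum.inr.injEq] at hj
    subst hj
    simpa [Formula.node] using h _ hφ

/-- On nodes of formulas, the quantifier over arguments ranges over the immediate subformulas.
Letters have kind `0` and impose no condition. -/
theorem nodeCoherent_iff (C : List (Formula J)) (S : List (List (List (Alphabet J)))) :
    NodeCoherent (C.map Formula.node) S ↔
      Coherent {φ | φ ∈ C} fun (t : {t // t ∈ S}) φ => φ.word ∈ t.1 := by
  simp only [NodeCoherent, List.forall_mem_map, word_node]
  constructor
  · intro h
    refine ⟨fun t φ hφ => ?_, fun t φ ψ hφ => ?_, fun t j φ hφ => ?_, fun t j φ hφ => ?_⟩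
    · simpa [Formula.node] using (h t.1 t.2 _ hφ).1 rfl
    · simpa [Formula.node] using (h t.1 t.2 _ hφ).2.1 rfl
    · have := (h t.1 t.2 _ hφ).2.2.1 rfl
      rw [this]
      simp only [← nodeAccess_iff]
      simp [Formula.node]
    · have := (h t.1 t.2 _ hφ).2.2.2 rfl
      rw [this]
      simp only [← nodeAlike_iff]
      simp [Formula.node]
  · intro h t ht φ hφ
    cases φ with
    | letter n => simp [Formula.node, kind]
    | neg φ => simpa [Formula.node, kind] using h.neg ⟨t, ht⟩ φ hφ
    | and φ ψ => simpa [Formula.node, kind] using h.and ⟨t, ht⟩ φ ψ hφ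
    | K j φ =>
      have := h.K ⟨t, ht⟩ j φ hφ
      simp only [← nodeAccess_iff] at this
      simpa [Formula.node, kind] using this
    | A j φ =>
      have := h.A ⟨t, ht⟩ j φ hφ
      simp only [← nodeAlike_iff] at this
      simpa [Formula.node, kind] using this

/-- A coherent `S` is the state space of a model; conversely the types realised in a model form a
coherent `S`. -/
theorem mem_logic_iff_nodeCoherent (φ : Formula J) :
    φ ∈ logic.{v, w} J ↔
      ∀ S ∈ ((φ.subs.map Formula.node).map Node.word).sublists'.sublists',
        NodeCoherent (φ.subs.map Formula.node) S → ∀ t ∈ S, φ.word ∈ t := by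
  classical
  have hmap : (φ.subs.map Formula.node).map Node.word = φ.subs.map Formula.word := by
    simp [Function.comp_def, word_node]
  rw [hmap]
  constructor
  · intro h S _ hS t ht
    by_contra hφ
    rw [nodeCoherent_iff] at hS
    obtain ⟨n, ⟨e⟩⟩ := Finite.exists_equiv_fin {t // t ∈ S}
    have hc := hS.transfer (subClosed_subs φ) (Ω' := ULift.{w} (Fin n))
      (t' := fun k ψ => ψ.word ∈ (e.symm k.down).1)
      (fun t => ⟨⟨e t⟩, fun _ _ => by simp⟩) (fun k => ⟨e.symm k.down, fun _ _ => Iff.rfl⟩)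
    exact hc.not_valid (subClosed_subs φ) (mem_subs_self φ) (σ := ⟨e ⟨t, ht⟩⟩)
      (by simpa using hφ) (h _ _)
  · intro h Ω M val
    -- Filtering fixes the order of the words, so a type is literally a sublist; the realised types
    -- are likewise filtered from the list of all sublists.
    let type : Ω → List (List (Alphabet J)) := fun σ =>
      (φ.subs.map Formula.word).filter fun x => ∃ ψ : Formula J, ψ.word = x ∧
        σ ∈ M.toStandard.interp val ψ
    have htype : ∀ σ, ∀ ψ ∈ φ.subs, (σ ∈ M.toStandard.interp val ψ ↔ ψ.word ∈ type σ) := by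
      intro σ ψ hψ
      simp only [type, List.mem_filter, decide_eq_true_eq]
      constructor
      · exact fun hσ => ⟨List.mem_map_of_mem hψ, ψ, rfl, hσ⟩
      · rintro ⟨-, χ, hχ, hσ⟩
        rwa [← word_injective hχ]
    have hmem : ∀ σ, type σ ∈ (φ.subs.map Formula.word).sublists'.filter
        (fun t => ∃ σ, t = type σ) := fun σ => by
      simp only [List.mem_filter, decide_eq_true_eq, List.mem_sublists']
      exact ⟨List.filter_sublist, σ, rfl⟩
    have hS := h _ (List.mem_sublists'.2 (List.filter_sublist
      (p := fun t => decide (∃ σ, t = type σ)))) ((nodeCoherent_iff _ _).2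
        ((M.coherent val _).transfer (subClosed_subs φ)
          (fun σ => ⟨⟨type σ, hmem σ⟩, htype σ⟩) fun t => ?_))
    · exact Set.eq_univ_of_forall fun σ =>
        (htype σ φ (mem_subs_self φ)).2 (hS _ (hmem σ))
    · obtain ⟨t, ht⟩ := t
      simp only [List.mem_filter, decide_eq_true_eq] at ht
      obtain ⟨-, σ, rfl⟩ := ht
      exact ⟨σ, htype σ⟩

end Criterion

/-! ### Computability of the criterion -/

section Computability

variable {α β : Type*} [Primcodable α] [Primcodable β]

theorem primrecPred_imp {p q : α → Prop} (hp : PrimrecPred p) (hq : PrimrecPred q) :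
    PrimrecPred fun a => p a → q a :=
  (hp.not.or hq).of_eq fun _ => imp_iff_not_or.symm

theorem primrecPred_iff {p q : α → Prop} (hp : PrimrecPred p) (hq : PrimrecPred q) :
    PrimrecPred fun a => p a ↔ q a :=
  ((primrecPred_imp hp hq).and (primrecPred_imp hq hp)).of_eq fun _ =>
    iff_iff_implies_and_implies.symm

theorem primrecPred_forall_mem {f : α → List β} {p : α → β → Prop} (hf : Primrec f)
    (hp : PrimrecPred fun a : α × β => p a.1 a.2) : PrimrecPred fun a => ∀ b ∈ f a, p a b :=
  (PrimrecRel.forall_mem_list (R := fun b a => p a b)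
    (hp.comp (Primrec.snd.pair Primrec.fst))).comp hf Primrec.id

theorem primrecPred_mem {f : α → β} {g : α → List β} (hf : Primrec f) (hg : Primrec g) :
    PrimrecPred fun a => f a ∈ g a :=
  ((PrimrecRel.exists_mem_list (Primrec.eq (α := β))).comp hg hf).of_eq fun _ => by simp

theorem primrec_sublists' : Primrec (List.sublists' : List α → List (List α)) := by
  have : Primrec fun l : List α =>
      l.foldr (fun a L => L ++ L.map (List.cons a)) [[]] :=
    Primrec.list_foldr Primrec.id (Primrec.const [[]])
      (Primrec.list_append.comp (Primrec.snd.comp Primrec.snd)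
        (Primrec.list_map (Primrec.snd.comp Primrec.snd)
          (Primrec.list_cons.comp (Primrec.fst.comp (Primrec.snd.comp Primrec.fst))
            Primrec.snd).to₂).to₂).to₂
  refine this.of_eq fun l => ?_
  induction l with
  | nil => rfl
  | cons a l ih => rw [List.foldr_cons, ih, List.sublists'_cons]

variable {J : Type v} [Primcodable J]

theorem primrec_kind : Primrec (kind : Alphabet J → ℕ) :=
  (Primrec.sumCasesOn Primrec.id (Primrec.const 0).to₂
    (Primrec.sumCasesOn Primrec.snd
      (Primrec.cond Primrec.snd (Primrec.const 2) (Primrec.const 1)).to₂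
      (Primrec.sumCasesOn Primrec.snd (Primrec.const 3).to₂ (Primrec.const 4).to₂).to₂).to₂).of_eq
    fun s => by rcases s with n | (_ | _) | j | j <;> rfl

theorem primrec_arity : Primrec (arity : Alphabet J → ℕ) :=
  (Primrec.sumCasesOn Primrec.id (Primrec.const 0).to₂
    (Primrec.sumCasesOn Primrec.snd
      (Primrec.cond Primrec.snd (Primrec.const 2) (Primrec.const 1)).to₂
      (Primrec.const 1).to₂).to₂).of_eq
    fun s => by rcases s with n | (_ | _) | j | j <;> rfl

theorem primrec_nodeWord : Primrec (Node.word : Node J → List (Alphabet J)) :=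
  Primrec.list_cons.comp Primrec.fst (Primrec.list_flatten.comp Primrec.snd)

theorem primrec_parse : Primrec (parse : List (Alphabet J) → _) := by
  have hs : Primrec fun q : List (Alphabet J) ×
      (Alphabet J × (List (List (Alphabet J)) × List (Node J))) => q.2.1 :=
    Primrec.fst.comp Primrec.snd
  have hp : Primrec fun q : List (Alphabet J) ×
      (Alphabet J × (List (List (Alphabet J)) × List (Node J))) => q.2.2.1 :=
    Primrec.fst.comp (Primrec.snd.comp Primrec.snd)
  have ht := Primrec.list_take.comp (primrec_arity.comp hs) hp
  exact Primrec.list_foldr Primrec.id (Primrec.const _)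
    (Primrec.pair
      (Primrec.list_cons.comp (Primrec.list_cons.comp hs (Primrec.list_flatten.comp ht))
        (Primrec.list_drop.comp (primrec_arity.comp hs) hp))
      (Primrec.list_cons.comp (Primrec.pair hs ht)
        (Primrec.snd.comp (Primrec.snd.comp Primrec.snd)))).to₂

theorem primrecPred_nodeAccess {N : α → List (Node J)} {s : α → Alphabet J}
    {t t' : α → List (List (Alphabet J))} (hN : Primrec N) (hs : Primrec s) (ht : Primrec t)
    (ht' : Primrec t') : PrimrecPred fun a => NodeAccess (N a) (s a) (t a) (t' a) :=
  have hw := primrec_nodeWord.comp (Primrec.snd (α := α))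
  primrecPred_forall_mem hN <| primrecPred_imp
    (Primrec.eq.comp (Primrec.fst.comp Primrec.snd) (hs.comp Primrec.fst)) <| primrecPred_imp
      (primrecPred_mem hw (ht.comp Primrec.fst)) (primrecPred_mem hw (ht'.comp Primrec.fst))

theorem primrecPred_forall_mem_iff {l r r' : α → List β} (hl : Primrec l) (hr : Primrec r)
    (hr' : Primrec r') : PrimrecPred fun a => ∀ x ∈ l a, (x ∈ r a ↔ x ∈ r' a) :=
  primrecPred_forall_mem hl <| primrecPred_iff
    (primrecPred_mem Primrec.snd (hr.comp Primrec.fst))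
    (primrecPred_mem Primrec.snd (hr'.comp Primrec.fst))

theorem primrecPred_nodeAlike {N : α → List (Node J)} {s : α → Alphabet J}
    {t r r' : α → List (List (Alphabet J))} (hN : Primrec N) (hs : Primrec s) (ht : Primrec t)
    (hr : Primrec r) (hr' : Primrec r') :
    PrimrecPred fun a => NodeAlike (N a) (s a) (t a) (r a) (r' a) :=
  primrecPred_forall_mem hN <| primrecPred_imp
    (Primrec.eq.comp (Primrec.fst.comp Primrec.snd) (hs.comp Primrec.fst)) <| primrecPred_imp
      (primrecPred_mem (primrec_nodeWord.comp Primrec.snd) (ht.comp Primrec.fst))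
      (primrecPred_forall_mem_iff (Primrec.snd.comp Primrec.snd) (hr.comp Primrec.fst)
        (hr'.comp Primrec.fst))

theorem primrecPred_nodeCoherent {N : α → List (Node J)}
    {S : α → List (List (List (Alphabet J)))} (hN : Primrec N) (hS : Primrec S) :
    PrimrecPred fun a => NodeCoherent (N a) (S a) := by
  refine primrecPred_forall_mem hS (primrecPred_forall_mem (hN.comp Primrec.fst) ?_)
  have ha : Primrec fun q : (α × List (List (Alphabet J))) × Node J => q.1.1 :=
    Primrec.fst.comp Primrec.fst
  have ht : Primrec fun q : (α × List (List (Alphabet J))) × Node J => q.1.2 :=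
    Primrec.snd.comp Primrec.fst
  have hs : Primrec fun q : (α × List (List (Alphabet J))) × Node J => q.2.1 :=
    Primrec.fst.comp Primrec.snd
  have hx : Primrec fun q : (α × List (List (Alphabet J))) × Node J => q.2.2 :=
    Primrec.snd.comp Primrec.snd
  have hw : PrimrecPred fun q : (α × List (List (Alphabet J))) × Node J => q.2.word ∈ q.1.2 :=
    primrecPred_mem (primrec_nodeWord.comp Primrec.snd) ht
  have hk (k : ℕ) :
      PrimrecPred fun q : (α × List (List (Alphabet J))) × Node J => kind q.2.1 = k :=
    Primrec.eq.comp (primrec_kind.comp hs) (Primrec.const k)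
  refine (primrecPred_imp (hk 1) (primrecPred_iff hw ?_)).and <|
    (primrecPred_imp (hk 2) (primrecPred_iff hw ?_)).and <|
    (primrecPred_imp (hk 3) (primrecPred_iff hw ?_)).and
    (primrecPred_imp (hk 4) (primrecPred_iff hw ?_))
  · exact primrecPred_forall_mem hx (primrecPred_mem Primrec.snd (ht.comp Primrec.fst)).not
  · exact primrecPred_forall_mem hx (primrecPred_mem Primrec.snd (ht.comp Primrec.fst))
  · refine primrecPred_forall_mem (hS.comp ha) (primrecPred_imp ?_ ?_)
    · exact primrecPred_nodeAccess ((hN.comp ha).comp Primrec.fst) (hs.comp Primrec.fst)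
        (ht.comp Primrec.fst) Primrec.snd
    · exact primrecPred_forall_mem (hx.comp Primrec.fst)
        (primrecPred_mem Primrec.snd (Primrec.snd.comp Primrec.fst))
  · have h₁ := Primrec.fst.comp (Primrec.fst (α := ((α × List (List (Alphabet J))) × Node J) ×
      List (List (Alphabet J))) (β := List (List (Alphabet J))))
    refine primrecPred_forall_mem (hS.comp ha) (primrecPred_forall_mem
      ((hS.comp ha).comp Primrec.fst) (primrecPred_imp ?_ ?_))
    · exact primrecPred_nodeAlike ((hN.comp ha).comp h₁) (hs.comp h₁) (ht.comp h₁)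
        (Primrec.snd.comp Primrec.fst) Primrec.snd
    · exact primrecPred_forall_mem_iff (hx.comp h₁) (Primrec.snd.comp Primrec.fst) Primrec.snd

/-- Well-formedness and the criterion are both expressed through `parse x`, and all quantifiers are
bounded by lists computed from it, so the test is primitive recursive. -/
theorem decidableSet_logic : DecidableSet (logic.{v, w} J) := by
  have hN : Primrec fun x : List (Alphabet J) => (parse x).2 := Primrec.snd.comp primrec_parse
  have h : PrimrecPred fun x : List (Alphabet J) =>
      ((parse x).1.length = 1 ∧ ∀ n ∈ (parse x).2, n.2.length = arity n.1) ∧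
        ∀ S ∈ ((parse x).2.map Node.word).sublists'.sublists', NodeCoherent (parse x).2 S →
          ∀ t ∈ S, x ∈ t := by
    refine PrimrecPred.and (PrimrecPred.and ?_ ?_) ?_
    · exact Primrec.eq.comp (Primrec.list_length.comp (Primrec.fst.comp primrec_parse))
        (Primrec.const 1)
    · exact primrecPred_forall_mem hN (Primrec.eq.comp
        (Primrec.list_length.comp (Primrec.snd.comp Primrec.snd))
        (primrec_arity.comp (Primrec.fst.comp Primrec.snd)))
    · refine primrecPred_forall_mem (primrec_sublists'.comp (primrec_sublists'.comp
        (Primrec.list_map hN (primrec_nodeWord.comp Primrec.snd).to₂))) (primrecPred_imp ?_ ?_)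
      · exact primrecPred_nodeCoherent (hN.comp Primrec.fst) Primrec.snd
      · exact primrecPred_forall_mem Primrec.snd
          (primrecPred_mem (Primrec.fst.comp Primrec.fst) Primrec.snd)
  refine (h.of_eq fun x => ?_).computablePred
  rw [← exists_word_eq_iff]
  constructor
  · rintro ⟨⟨φ, rfl⟩, hx⟩
    rw [parse_word] at hx
    exact ⟨φ, (mem_logic_iff_nodeCoherent φ).2 hx, rfl⟩
  · rintro ⟨φ, hφ, rfl⟩
    refine ⟨⟨φ, rfl⟩, ?_⟩
    rw [parse_word]
    exact (mem_logic_iff_nodeCoherent φ).1 hφ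

end Computability

end Unawareness

/-- Soundness and completeness, the finite model property, and decidability of the logic of
partitional models. The set `I` of agents is arbitrary; for decidability, agents have to be
represented by finite data, so it is stated for every effectively coded family of (names of)
agents `e : J ↪ I`; if `I` itself is effectively coded, take `J = I` and the identity. -/
theorem theorem4 (I : Type u) :
    (∀ φ : Formula I, φ ∈ logic.{u, w} I ↔ Derivable φ) ∧
    (∀ φ : Formula I, ¬ Derivable φ →
      ∃ (n : ℕ) (M : PartitionalModel I (Fin n)), ¬ M.Valid φ) ∧
    (∀ (J : Type v) [Primcodable J] (e : J ↪ I),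
      DecidableSet {φ : Formula J | φ.map e ∈ logic.{u, w} I}) :=
  ⟨mem_logic_iff_derivable, fun _ => exists_finite_not_valid, fun J _ e => by
    simp only [map_mem_logic_iff]
    exact decidableSet_logic⟩
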